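/- Let $n\ge 2$ be even. Alice has $n$ and Bob has $n+1$ two-outcome observables, i.e. Hermitian operators with eigenvalues $\pm1$: $A_1,\dots,A_n$ on a complex Hilbert space $\mathcal H_A$ and $B_1,\dots,B_{n+1}$ on a complex Hilbert space $\mathcal H_B$, both of arbitrary (possibly infinite) dimension, and they share a unit vector $|\psi\rangle\in\mathcal H_A\otimes\mathcal H_B$. Write $\langle A_iB_j\rangle=\langle\psi|A_i\otimes B_j|\psi\rangle$ and, for $a,b\in\{0,1\}$, $$p(a,b|A_i,B_j)=\langle\psi|\,\tfrac{1}{2}\big(\mathbb 1+(-1)^aA_i\big)\otimes\tfrac{1}{2}\big(\mathbb 1+(-1)^bB_j\big)\,|\psi\rangle .$$ Consider the modified chained Bell inequality $$\widetilde I^{\,n}_{\mathrm{ch}}:=\sum_{i=1}^{n}\big(\langle A_iB_i\rangle+\langle A_{i+1}B_i\rangle\big)+\langle A_1B_{n+1}\rangle\le 2n-1,\qquad A_{n+1}:=-A_1 .$$ Then: 1. The inequality holds in every local hidden variable model, i.e. whenever $\langle A_iB_j\rangle=\int\alpha_i\beta_j\,d\mu$ with a probability measure $\mu$ and measurable functions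 $\alpha_i,\beta_j$ with values in $[-1,1]$. 2. The maximal value of $\widetilde I^{\,n}_{\mathrm{ch}}$ over all quantum realizations $(|\psi\rangle,A_i,B_j)$ as above is attained and equals $B_n^{\max}+1$ with $B_n^{\max}=2n\cos\frac{\pi}{2n}$; moreover $B_n^{\max}+1>2n-1$. 3. Every quantum realization that attains this maximum satisfies $(A_1\otimes\mathbb 1)|\psi\rangle=(\mathbb 1\otimes B_{n+1})|\psi\rangle$, and $$p(a,b|A_{n/2+1},B_{n+1})=\tfrac14\qquad\text{for all }a,b\in\{0,1\},$$ so that the pair of outcomes of $A_{n/2+1}$ and $B_{n+1}$ is uniformly distributed and carries two bits of perfect randomness: its min-entropy $-\log_2\max_{a,b}p(a,b|A_{n/2+1},B_{n+1})$ equals $2$. -/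

import Mathlib

open scoped TensorProduct

universe u v w

namespace ChainedBell

noncomputable section

/-- The Hilbert-space tensor product of `HA` and `HB`: the completion of the algebraic tensor
product with respect to its canonical inner product. In finite dimension this is the usual tensor
product. -/
abbrev HilbertTensor (HA : Type u) (HB : Type v)
    [NormedAddCommGroup HA] [InnerProductSpace ℂ HA]
    [NormedAddCommGroup HB] [InnerProductSpace ℂ HB] : Type (max u v) :=
  UniformSpace.Completion (HA ⊗[ℂ] HB)

section Operators

variable {HA : Type u} {HB : Type v}
  [NormedAddCommGroup HA] [InnerProductSpace ℂ HA]
  [NormedAddCommGroup HB] [InnerProductSpace ℂ HB]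

/-- The operator `A ⊗ B` on the Hilbert-space tensor product. -/
def tensorOp (A : HA →L[ℂ] HA) (B : HB →L[ℂ] HB) :
    HilbertTensor HA HB →L[ℂ] HilbertTensor HA HB :=
  (TensorProduct.mapL A B).completion

/-- `A ⊗ B` acts on product vectors in the expected way. -/
theorem tensorOp_tmul (A : HA →L[ℂ] HA) (B : HB →L[ℂ] HB) (x : HA) (y : HB) :
    tensorOp A B ((x ⊗ₜ[ℂ] y : HA ⊗[ℂ] HB) : HilbertTensor HA HB)
      = ((A x ⊗ₜ[ℂ] B y : HA ⊗[ℂ] HB) : HilbertTensor HA HB) := by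
  simp [tensorOp]

/-- A two-outcome observable: a Hermitian operator `A` with eigenvalues `±1`. -/
def IsObservable {H : Type u} [NormedAddCommGroup H] [InnerProductSpace ℂ H] [CompleteSpace H]
    (A : H →L[ℂ] H) : Prop :=
  IsSelfAdjoint A ∧ A * A = 1

/-- The projection `(1 + (-1)^a A) / 2` onto the outcome `a = 0, 1` of the observable `A`. -/
def outcomeProj {H : Type u} [NormedAddCommGroup H] [InnerProductSpace ℂ H]
    (A : H →L[ℂ] H) (a : Fin 2) : H →L[ℂ] H :=
  (1 / 2 : ℂ) • (1 + ((-1 : ℂ) ^ (a : ℕ)) • A)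

end Operators

/-- A quantum realization for the modified chained inequality with `n` settings: a unit vector in
the tensor product of the two Hilbert spaces, observables `A 1, …, A n` of Alice and observables
`B 1, …, B (n + 1)` of Bob. The values of `A` and `B` at other indices play no role. -/
structure Realization (n : ℕ) (HA : Type u) (HB : Type v)
    [NormedAddCommGroup HA] [InnerProductSpace ℂ HA] [CompleteSpace HA]
    [NormedAddCommGroup HB] [InnerProductSpace ℂ HB] [CompleteSpace HB] where
  /-- the shared pure state -/
  ψ : HilbertTensor HA HB
  /-- Alice's observables -/
  A : ℕ → (HA →L[ℂ] HA)
  /-- Bob's observables -/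
  B : ℕ → (HB →L[ℂ] HB)
  norm_ψ : ‖ψ‖ = 1
  observable_A : ∀ i ∈ Finset.Icc 1 n, IsObservable (A i)
  observable_B : ∀ j ∈ Finset.Icc 1 (n + 1), IsObservable (B j)

/-- The chained Bell functional `∑_{i=1}^n (⟨A_i B_i⟩ + ⟨A_{i+1} B_i⟩)`, with the convention
`A_{n+1} = -A_1`, as a function of the correlators `E i j = ⟨A_i B_j⟩`. -/
def chained (n : ℕ) (E : ℕ → ℕ → ℝ) : ℝ :=
  ∑ i ∈ Finset.Icc 1 n, (E i i + if i = n then -E 1 i else E (i + 1) i)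

/-- The modified chained functional: the chained functional plus `⟨A_1 B_{n+1}⟩`. -/
def modifiedChained (n : ℕ) (E : ℕ → ℕ → ℝ) : ℝ :=
  chained n E + E 1 (n + 1)

namespace Realization

variable {n : ℕ} {HA : Type u} {HB : Type v}
  [NormedAddCommGroup HA] [InnerProductSpace ℂ HA] [CompleteSpace HA]
  [NormedAddCommGroup HB] [InnerProductSpace ℂ HB] [CompleteSpace HB]

/-- The correlator `⟨ψ| A_i ⊗ B_j |ψ⟩`. -/
def corr (R : Realization n HA HB) (i j : ℕ) : ℝ :=
  (inner ℂ R.ψ (tensorOp (R.A i) (R.B j) R.ψ)).re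

/-- The value of the modified chained functional in the realization. -/
def value (R : Realization n HA HB) : ℝ :=
  modifiedChained n R.corr

/-- The probability `p(a, b | A_i, B_j) = ⟨ψ| M_{A_i}^a ⊗ M_{B_j}^b |ψ⟩`. -/
def prob (R : Realization n HA HB) (i j : ℕ) (a b : Fin 2) : ℝ :=
  (inner ℂ R.ψ (tensorOp (outcomeProj (R.A i) a) (outcomeProj (R.B j) b) R.ψ)).re

end Realization

/-- All values that the modified chained functional takes in quantum theory. -/
def quantumValues (n : ℕ) : Set ℝ :=
  {x | ∃ (HA : Type u) (HB : Type v)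
    (_ : NormedAddCommGroup HA) (_ : InnerProductSpace ℂ HA) (_ : CompleteSpace HA)
    (_ : NormedAddCommGroup HB) (_ : InnerProductSpace ℂ HB) (_ : CompleteSpace HB)
    (R : Realization n HA HB), x = R.value}

/-- All values that the modified chained functional takes in local hidden variable models: the
correlators are `∫ α_i β_j dμ` for a probability measure `μ` on the space of hidden variables and
local response functions with values in `[-1, 1]`. -/
def localValues (n : ℕ) : Set ℝ :=
  {x | ∃ (Ω : Type w) (_ : MeasurableSpace Ω) (μ : MeasureTheory.Measure Ω)
    (_ : MeasureTheory.IsProbabilityMeasure μ) (α β : ℕ → Ω → ℝ),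
    (∀ i, Measurable (α i)) ∧ (∀ j, Measurable (β j)) ∧
    (∀ i ω, |α i ω| ≤ 1) ∧ (∀ j ω, |β j ω| ≤ 1) ∧
    x = modifiedChained n (fun i j => ∫ ω, α i ω * β j ω ∂μ)}

/-- A realization violates the modified chained inequality maximally if its value is the largest
one among all quantum realizations. -/
def Realization.IsMaximal {n : ℕ} {HA : Type u} {HB : Type v}
    [NormedAddCommGroup HA] [InnerProductSpace ℂ HA] [CompleteSpace HA]
    [NormedAddCommGroup HB] [InnerProductSpace ℂ HB] [CompleteSpace HB]
    (R : Realization n HA HB) : Prop :=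
  IsGreatest (quantumValues.{u, v} n) R.value

/-- The number of random bits (min-entropy, in bits) in a pair of outcomes with joint
distribution `p`: minus the binary logarithm of the largest probability. -/
def minEntropy (p : Fin 2 → Fin 2 → ℝ) : ℝ :=
  -Real.logb 2 (⨆ ab : Fin 2 × Fin 2, p ab.1 ab.2)

end

end ChainedBell

/-! The vectors aᵢ = (Aᵢ ⊗ 1)ψ and bⱼ = (1 ⊗ Bⱼ)ψ are unit vectors, and the chained functional is
the sum of real inner products of neighbours along a₁, b₁, …, aₙ, bₙ, −a₁. `chain_gap_eq` writes its
distance to 2n cos(π/2n) as a sum of squares, and Cauchy–Schwarz bounds the extra term by 1; a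
two-qubit realization attains both bounds at once. For numbers in [−1, 1] the same chain telescopes
to the local bound (`sum_mul_antiperiodic_le`).

A maximal realization saturates both quantum bounds. The extra term gives A₁ψ = Bₙ₊₁ψ. Vanishing
squares space the chain regularly in a plane; as n is even, its middle vertex belongs to Alice, so
B₁ψ = cos(π/2n) A₁ψ + sin(π/2n) A_{n/2+1}ψ (`eq_rotation_of_chained_eq`). Squaring B₁ makes A₁ and
A_{n/2+1} anticommute on ψ (`anticommute_of_rotation`). Each of the two acts on ψ like an operator
of Bob, so their expectations vanish (`inner_eq_zero_of_anticommute`), and the anticommutator kills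
the remaining correlator. -/

namespace ChainedBell

/-! ### Antiperiodic chains: the classical bound, the Hilbert-space bound and its equality case. -/

section Chain

open Real

/-- The vertices `a 1, b 1, a 2, b 2, …, a n, b n, -a 1` of the chain. -/
def chainSeq {G : Type*} [Neg G] (n : ℕ) (a b : ℕ → G) (k : ℕ) : G :=
  if k = 2 * n then -a 1 else if Even k then a (k / 2 + 1) else b (k / 2 + 1)

variable {G : Type*} [Neg G] {n : ℕ} (a b : ℕ → G)

theorem chainSeq_two_mul {i : ℕ} (hi : i < n) : chainSeq n a b (2 * i) = a (i + 1) := by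
  simp [chainSeq, hi.ne]

theorem chainSeq_two_mul_add_one (i : ℕ) : chainSeq n a b (2 * i + 1) = b (i + 1) := by
  have h1 : 2 * i + 1 ≠ 2 * n := by omega
  have h2 : ¬ Even (2 * i + 1) := by simp
  have h3 : (2 * i + 1) / 2 = i := by omega
  simp only [chainSeq, h1, h2, h3, if_false]

theorem chainSeq_last : chainSeq n a b (2 * n) = -a 1 := by simp [chainSeq]

theorem sum_range_two_mul {M : Type*} [AddCommMonoid M] (f : ℕ → M) (n : ℕ) :
    ∑ k ∈ Finset.range (2 * n), f k = ∑ i ∈ Finset.range n, (f (2 * i) + f (2 * i + 1)) := by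
  induction n with
  | zero => simp
  | succ n ih =>
    rw [show 2 * (n + 1) = 2 * n + 1 + 1 by ring, Finset.sum_range_succ, Finset.sum_range_succ, ih,
      Finset.sum_range_succ, add_assoc]

/-- The chained functional is the sum of a symmetric pairing over the edges of the chain. -/
theorem chained_eq_sum_chainSeq (F : G → G → ℝ) (hsymm : ∀ x y, F x y = F y x)
    (hneg : ∀ x y, F x (-y) = -F x y) :
    chained n (fun i j => F (a i) (b j)) =
      ∑ k ∈ Finset.range (2 * n), F (chainSeq n a b k) (chainSeq n a b (k + 1)) := by
  rw [sum_range_two_mul, chained, ← Finset.Ico_add_one_right_eq_Icc,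
    Finset.sum_Ico_eq_sum_range, Nat.add_sub_cancel]
  refine Finset.sum_congr rfl fun i hi => ?_
  have hi := Finset.mem_range.1 hi
  rw [chainSeq_two_mul a b hi, chainSeq_two_mul_add_one, add_comm 1 i]
  congr 1
  by_cases h : i + 1 = n
  · rw [if_pos h, show 2 * i + 1 + 1 = 2 * n by omega, chainSeq_last, hneg, hsymm]
  · rw [if_neg h, show 2 * i + 1 + 1 = 2 * (i + 1) by ring,
      chainSeq_two_mul a b (by omega : i + 1 < n), hsymm]

theorem chainSeq_induction {p : G → Prop} (hn : 1 ≤ n) (ha : ∀ i ∈ Finset.Icc 1 n, p (a i))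
    (hb : ∀ i ∈ Finset.Icc 1 n, p (b i)) (hneg : ∀ x, p x → p (-x)) {k : ℕ} (hk : k ≤ 2 * n) :
    p (chainSeq n a b k) := by
  unfold chainSeq
  split_ifs with h1 h2
  · exact hneg _ (ha 1 (Finset.mem_Icc.2 ⟨le_rfl, hn⟩))
  · exact ha _ (Finset.mem_Icc.2 (by omega))
  · exact hb _ (Finset.mem_Icc.2 (by omega))

/-- The classical bound on an antiperiodic chain of numbers in `[-1, 1]`. -/
theorem sum_mul_antiperiodic_le (M : ℕ) (x : ℕ → ℝ) (y : ℝ) (hx : ∀ k ≤ M + 2, |x k| ≤ 1)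
    (hy : |y| ≤ 1) (hlast : x (M + 2) = -x 0) :
    ∑ k ∈ Finset.range (M + 2), x k * x (k + 1) + x 0 * y ≤ M + 1 := by
  have key : ∀ m ≤ M, ∑ k ∈ Finset.range m, x (k + 1) * x (k + 1 + 1) ≤
      m - |x 1 - x (m + 1)| := by
    intro m hm
    induction m with
    | zero => simp
    | succ m ih =>
      have ih := ih (by omega)
      have h1 := abs_le.1 (hx (m + 1) (by omega))
      have h2 := abs_le.1 (hx (m + 1 + 1) (by omega))
      -- For p, q in [-1, 1], 1 - pq ∓ (p - q) factors as (1 ∓ p)(1 ± q) ≥ 0.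
      have h3 : |x (m + 1) - x (m + 1 + 1)| ≤ 1 - x (m + 1) * x (m + 1 + 1) :=
        abs_le.2 ⟨by nlinarith, by nlinarith⟩
      have h4 := abs_sub_le (x 1) (x (m + 1)) (x (m + 1 + 1))
      rw [Finset.sum_range_succ]
      push_cast
      linarith
  have hM := key M le_rfl
  -- By antiperiodicity the two end edges and the extra term share the factor `x 0`; the loss in
  -- `key` pays for |x 1 - x (M + 1)|.
  have h0 : x 0 * (x 1 - x (M + 1) + y) ≤ |x 1 - x (M + 1)| + 1 := by
    calc x 0 * (x 1 - x (M + 1) + y) ≤ |x 0 * (x 1 - x (M + 1) + y)| := le_abs_self _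
      _ = |x 0| * |x 1 - x (M + 1) + y| := abs_mul _ _
      _ ≤ 1 * |x 1 - x (M + 1) + y| :=
        mul_le_mul_of_nonneg_right (hx 0 (by omega)) (abs_nonneg _)
      _ ≤ |x 1 - x (M + 1)| + 1 := by
        rw [one_mul]; exact (abs_add_le _ _).trans (by linarith)
  rw [Finset.sum_range_succ, Finset.sum_range_succ', show M + 1 + 1 = M + 2 from rfl, hlast]
  linarith

theorem sin_mul_div_pos {M k : ℕ} (h1 : 1 ≤ k) (h2 : k ≤ M + 1) :
    0 < sin (k * (π / (M + 2))) := by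
  have h1' : (1 : ℝ) ≤ k := by exact_mod_cast h1
  have h2' : (k : ℝ) < M + 2 := by exact_mod_cast (by omega : k < M + 2)
  refine sin_pos_of_pos_of_lt_pi (by positivity) ?_
  rw [← mul_div_assoc, div_lt_iff₀ (by positivity), mul_comm]
  exact mul_lt_mul_of_pos_left h2' pi_pos

theorem chain_gap_term_nonneg {M j : ℕ} (hj : j < M) (x : ℝ) :
    0 ≤ x ^ 2 / (2 * sin ((j + 1 : ℕ) * (π / (M + 2))) * sin ((j + 2 : ℕ) * (π / (M + 2)))) := by
  have p1 := sin_mul_div_pos (M := M) (k := j + 1) (by omega) (by omega)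
  have p2 := sin_mul_div_pos (M := M) (k := j + 2) (by omega) (by omega)
  positivity

variable {E : Type*} [NormedAddCommGroup E] [InnerProductSpace ℝ E]

/-- The sum-of-squares decomposition of the gap between the sum of inner products along an
antiperiodic chain of unit vectors and its maximum. -/
theorem chain_gap_eq (M : ℕ) (v : ℕ → E) (hv : ∀ k ≤ M + 2, ‖v k‖ = 1)
    (hlast : v (M + 2) = -v 0) (s : ℕ → ℝ) (hs : ∀ k, s k = sin (k * (π / (M + 2)))) :
    (M + 2) * cos (π / (M + 2)) - ∑ k ∈ Finset.range (M + 2), inner ℝ (v k) (v (k + 1)) =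
      ∑ j ∈ Finset.range M,
        ‖s (j + 2) • v (j + 1) - s (j + 1) • v (j + 2) - s 1 • v 0‖ ^ 2 /
          (2 * s (j + 1) * s (j + 2)) := by
  set θ := π / ((M : ℝ) + 2) with hθ
  have hM : (0 : ℝ) < M + 2 := by positivity
  have hMθ : (M + 2) * θ = π := by rw [hθ]; field_simp
  have hθ0 : 0 < θ := div_pos pi_pos hM
  have hpos : ∀ k, 1 ≤ k → k ≤ M + 1 → 0 < s k := by
    intro k h1 h2
    have h1' : (1 : ℝ) ≤ k := by exact_mod_cast h1
    have h2' : (k : ℝ) ≤ M + 1 := by exact_mod_cast h2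
    rw [hs]
    exact sin_pos_of_pos_of_lt_pi (by positivity) (by nlinarith)
  have hs1 : s 1 = sin θ := by simp [hs]
  have hsM : s (M + 1) = sin θ := by
    rw [hs, ← sin_pi_sub θ, ← hMθ]
    congr 1; push_cast; ring
  have hcM : cos ((M + 1 : ℕ) * θ) = -cos θ := by
    rw [← cos_pi_sub θ, ← hMθ]
    congr 1; push_cast; ring
  have hs1pos : 0 < s 1 := hpos 1 le_rfl (by omega)
  -- The terms involving `v 0` telescope through `g`; its boundary values supply the two end edges
  -- and the missing 2 cos θ.
  let g : ℕ → ℝ := fun j =>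
    s 1 * cos ((j + 1 : ℕ) * θ) / s (j + 1) - s 1 / s (j + 1) * inner ℝ (v (j + 1)) (v 0)
  have hterm : ∀ j ∈ Finset.range M,
      ‖s (j + 2) • v (j + 1) - s (j + 1) • v (j + 2) - s 1 • v 0‖ ^ 2 /
          (2 * s (j + 1) * s (j + 2)) =
        cos θ - inner ℝ (v (j + 1)) (v (j + 2)) + (g j - g (j + 1)) := by
    intro j hj
    have hj := Finset.mem_range.1 hj
    have p1 := hpos (j + 1) (by omega) (by omega)
    have p2 := hpos (j + 2) (by omega) (by omega)
    have n1 := hv (j + 1) (by omega)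
    have n2 := hv (j + 2) (by omega)
    have n0 := hv 0 (by omega)
    have e2 : s (j + 2) = s (j + 1) * cos θ + cos ((j + 1 : ℕ) * θ) * s 1 := by
      rw [hs1, hs, hs, ← sin_add]; congr 1; push_cast; ring
    have c2 : cos ((j + 2 : ℕ) * θ) = cos ((j + 1 : ℕ) * θ) * cos θ - s (j + 1) * s 1 := by
      rw [hs1, hs, ← cos_add]; congr 1; push_cast; ring
    have q1 : s (j + 1) ^ 2 + cos ((j + 1 : ℕ) * θ) ^ 2 = 1 := by
      rw [hs]; exact sin_sq_add_cos_sq _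
    have q : s 1 ^ 2 + cos θ ^ 2 = 1 := by rw [hs1]; exact sin_sq_add_cos_sq _
    simp only [g]
    rw [norm_sub_sq_real, norm_sub_sq_real]
    simp only [norm_smul, inner_sub_left, real_inner_smul_left, real_inner_smul_right, n1, n2, n0,
      mul_one, Real.norm_eq_abs, sq_abs, show j + 1 + 1 = j + 2 from rfl, c2]
    generalize hc1 : cos ((j + 1 : ℕ) * θ) = C at *
    generalize cos θ = c at *
    generalize inner ℝ (v (j + 1)) (v (j + 2)) = X
    generalize inner ℝ (v (j + 1)) (v 0) = Y
    generalize inner ℝ (v (j + 2)) (v 0) = Z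
    have : s (j + 2) ^ 2 + s (j + 1) ^ 2 + s 1 ^ 2 = 2 * s (j + 1) * s (j + 2) * c
        + 2 * s 1 * (C * s (j + 2) - (C * c - s (j + 1) * s 1) * s (j + 1)) := by
      generalize s (j + 1) = t at *
      generalize s 1 = r at *
      rw [e2]
      linear_combination -t ^ 2 * q - r ^ 2 * q1
    field_simp
    linear_combination this
  rw [Finset.sum_congr rfl hterm, Finset.sum_add_distrib, Finset.sum_range_sub' g M,
    Finset.sum_sub_distrib, Finset.sum_range_succ, Finset.sum_range_succ',
    show M + 1 + 1 = M + 2 from rfl, hlast, inner_neg_right]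
  simp only [g, hsM, hcM, hs1, Finset.sum_const, Finset.card_range, nsmul_eq_mul, zero_add,
    Nat.cast_one, one_mul, real_inner_comm (v 0) (v 1)]
  rw [hs1] at hs1pos
  field_simp
  ring

theorem sum_inner_chain_le (M : ℕ) (v : ℕ → E) (hv : ∀ k ≤ M + 2, ‖v k‖ = 1)
    (hlast : v (M + 2) = -v 0) :
    ∑ k ∈ Finset.range (M + 2), inner ℝ (v k) (v (k + 1)) ≤ (M + 2) * cos (π / (M + 2)) := by
  have h := chain_gap_eq M v hv hlast (fun k => sin (k * (π / (M + 2)))) fun _ => rfl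
  have h0 := Finset.sum_nonneg fun j hj =>
    chain_gap_term_nonneg (M := M) (Finset.mem_range.1 hj)
      ‖sin ((j + 2 : ℕ) * (π / (M + 2))) • v (j + 1)
        - sin ((j + 1 : ℕ) * (π / (M + 2))) • v (j + 2)
        - sin ((1 : ℕ) * (π / (M + 2))) • v 0‖
  rw [← h] at h0
  linarith

/-- A chain of unit vectors attaining the maximum is regularly spaced in a plane. -/
theorem chain_eq_of_sum_eq (M : ℕ) (v : ℕ → E) (hv : ∀ k ≤ M + 2, ‖v k‖ = 1)
    (hlast : v (M + 2) = -v 0)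
    (heq : ∑ k ∈ Finset.range (M + 2), inner ℝ (v k) (v (k + 1)) =
      (M + 2) * cos (π / (M + 2))) {k : ℕ} (hk : k ≤ M) :
    sin (π / (M + 2)) • v (k + 1) =
      sin ((k + 1 : ℕ) * (π / (M + 2))) • v 1 - sin (k * (π / (M + 2))) • v 0 := by
  have h := chain_gap_eq M v hv hlast (fun k => sin (k * (π / (M + 2)))) fun _ => rfl
  -- A zero gap makes every square vanish, which is a recurrence for `v (j + 2)`.
  rw [heq, sub_self, eq_comm, Finset.sum_eq_zero_iff_of_nonneg fun j hj =>
    chain_gap_term_nonneg (Finset.mem_range.1 hj) _] at h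
  have hpos (k : ℕ) := sin_mul_div_pos (M := M) (k := k)
  -- This is sin(α+θ) sin(α-θ) = sin²α - sin²θ, needed to collect the coefficient of `v 0` in the
  -- induction.
  have hadd (k : ℕ) : sin ((k + 2 : ℕ) * (π / (M + 2))) * sin (k * (π / (M + 2)))
      + sin (π / (M + 2)) ^ 2 = sin ((k + 1 : ℕ) * (π / (M + 2))) ^ 2 := by
    have e1 : ((k + 2 : ℕ) : ℝ) * (π / (M + 2)) = (k + 1 : ℕ) * (π / (M + 2)) + π / (M + 2) := by
      push_cast; ring
    have e2 : (k : ℝ) * (π / (M + 2)) = (k + 1 : ℕ) * (π / (M + 2)) - π / (M + 2) := by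
      push_cast; ring
    rw [e1, e2, sin_add, sin_sub]
    have q1 := sin_sq_add_cos_sq ((k + 1 : ℕ) * (π / ((M : ℝ) + 2)))
    have q2 := sin_sq_add_cos_sq (π / ((M : ℝ) + 2))
    linear_combination sin ((k + 1 : ℕ) * (π / ((M : ℝ) + 2))) ^ 2 * q2
      - sin (π / ((M : ℝ) + 2)) ^ 2 * q1
  generalize π / ((M : ℝ) + 2) = θ at *
  induction k with
  | zero => simp
  | succ k ih =>
    have p1 := hpos (k + 1) (by omega) (by omega)
    have p2 := hpos (k + 2) (by omega) (by omega)
    have hz := h k (Finset.mem_range.2 (by omega))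
    rw [div_eq_zero_iff, or_iff_left (by positivity), sq_eq_zero_iff, norm_eq_zero,
      Nat.cast_one, one_mul, sub_sub, sub_eq_zero] at hz
    have ih := ih (by omega)
    refine smul_right_injective E p1.ne' ?_
    calc sin ((k + 1 : ℕ) * θ) • sin θ • v (k + 1 + 1)
        = sin θ • (sin ((k + 1 : ℕ) * θ) • v (k + 2) + sin θ • v 0) - sin θ ^ 2 • v 0 := by
          module
      _ = sin ((k + 2 : ℕ) * θ) • sin θ • v (k + 1) - sin θ ^ 2 • v 0 := by
          rw [← hz]; module
      _ = (sin ((k + 1 : ℕ) * θ) * sin ((k + 2 : ℕ) * θ)) • v 1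
          - (sin ((k + 2 : ℕ) * θ) * sin (k * θ) + sin θ ^ 2) • v 0 := by
          rw [ih]; module
      _ = sin ((k + 1 : ℕ) * θ) • (sin ((k + 2 : ℕ) * θ) • v 1
          - sin ((k + 1 : ℕ) * θ) • v 0) := by
          rw [hadd]; module

/-- In an extremal chain of even length, the second vertex is a rotation of the first one in the
plane spanned by the first vertex and the middle one. -/
theorem chain_one_eq_of_sum_eq {n : ℕ} (hn : 1 ≤ n) (v : ℕ → E)
    (hv : ∀ k ≤ 2 * n, ‖v k‖ = 1) (hlast : v (2 * n) = -v 0)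
    (heq : ∑ k ∈ Finset.range (2 * n), inner ℝ (v k) (v (k + 1)) =
      2 * n * cos (π / (2 * n))) :
    v 1 = cos (π / (2 * n)) • v 0 + sin (π / (2 * n)) • v n := by
  obtain ⟨m, rfl⟩ : ∃ m, n = m + 1 := ⟨n - 1, by omega⟩
  have hcast : (2 * (m + 1 : ℕ) : ℝ) = (2 * m : ℕ) + 2 := by push_cast; ring
  rw [hcast] at heq ⊢
  -- At `k = m` the coefficient angles are π/2 and π/2 - θ, leaving sin θ • v n = v 1 - cos θ • v 0.
  have h := chain_eq_of_sum_eq (2 * m) v hv hlast heq (k := m) (by omega)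
  have e1 : ((m + 1 : ℕ) : ℝ) * (π / ((2 * m : ℕ) + 2)) = π / 2 := by
    push_cast; field_simp
  have e2 : (m : ℝ) * (π / ((2 * m : ℕ) + 2)) = π / 2 - π / ((2 * m : ℕ) + 2) := by
    push_cast; field_simp; ring
  rw [e1, e2, sin_pi_div_two, sin_pi_div_two_sub, one_smul] at h
  rw [h]; abel

end Chain

/-! ### Anticommutation on a single vector. -/

section Anticommuting

variable {E : Type*} [NormedAddCommGroup E] [InnerProductSpace ℂ E]

/-- If `X` anticommutes with an involution `Y` on `ψ` and `Y` acts on `ψ` like a symmetric operator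
commuting with `X` and `Y`, then `X` has expectation zero. -/
theorem inner_eq_zero_of_anticommute {X Y W : E →L[ℂ] E} {ψ : E}
    (hY : (Y : E →ₗ[ℂ] E).IsSymmetric) (hW : (W : E →ₗ[ℂ] E).IsSymmetric)
    (hYY : ∀ x, Y (Y x) = x)
    (hXW : ∀ x, X (W x) = W (X x)) (hYW : ∀ x, Y (W x) = W (Y x))
    (hanti : X (Y ψ) + Y (X ψ) = 0) (hψ : Y ψ = W ψ) :
    inner ℂ ψ (X ψ) = 0 := by
  -- `W` need not be an involution; it inherits this from `Y` at `ψ` only, which suffices.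
  have hWW : W (W ψ) = ψ := by rw [← hψ, ← hYW, ← hψ, hYY]
  have h : inner ℂ ψ (X ψ) = -inner ℂ ψ (X ψ) := by
    calc inner ℂ ψ (X ψ) = inner ℂ (Y (Y ψ)) (X ψ) := by rw [hYY]
      _ = inner ℂ (Y ψ) (Y (X ψ)) := hY _ _
      _ = -inner ℂ (W ψ) (W (X ψ)) := by
        rw [eq_neg_of_add_eq_zero_right hanti, inner_neg_right, hψ, hXW]
      _ = -inner ℂ (W (W ψ)) (X ψ) := congrArg Neg.neg (hW (W ψ) (X ψ)).symm
      _ = -inner ℂ ψ (X ψ) := by rw [hWW]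
  exact self_eq_neg.1 h

/-- Two observables commuting with an observable `B` that acts on `ψ` like a proper rotation of
them anticommute on `ψ`. -/
theorem anticommute_of_rotation {X Y B : E →L[ℂ] E} {ψ : E} {c t : ℝ}
    (hX : ∀ x, X (X x) = x) (hY : ∀ x, Y (Y x) = x) (hB : ∀ x, B (B x) = x)
    (hXB : ∀ x, X (B x) = B (X x)) (hYB : ∀ x, Y (B x) = B (Y x))
    (hct : c ^ 2 + t ^ 2 = 1) (hc : c ≠ 0) (ht : t ≠ 0)
    (hψ : B ψ = (c : ℂ) • X ψ + (t : ℂ) • Y ψ) : X (Y ψ) + Y (X ψ) = 0 := by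
  -- Commuting `B` past `X` and `Y` lets the rotation be applied twice; the cross terms form the
  -- anticommutator.
  have h1 : B (B ψ) = ψ + ((c : ℂ) * t) • (X (Y ψ) + Y (X ψ)) := by
    have hct' : (c : ℂ) ^ 2 + (t : ℂ) ^ 2 = 1 := by exact_mod_cast hct
    rw [congrArg B hψ]
    rw [map_add, map_smul, map_smul, ← hXB, ← hYB, hψ]
    simp only [map_add, map_smul, hX, hY]
    calc _ = ((c : ℂ) ^ 2 + (t : ℂ) ^ 2) • ψ + ((c : ℂ) * t) • (X (Y ψ) + Y (X ψ)) := by module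
      _ = _ := by rw [hct', one_smul]
  rw [hB, left_eq_add, smul_eq_zero] at h1
  exact h1.resolve_left (by simp [hc, ht])

end Anticommuting

/-! ### Calculus of A ⊗ B on the completed tensor product. -/

section TensorOp

variable {HA : Type u} {HB : Type v}
  [NormedAddCommGroup HA] [InnerProductSpace ℂ HA]
  [NormedAddCommGroup HB] [InnerProductSpace ℂ HB]

open UniformSpace TensorProduct

theorem tensorOp_coe (A : HA →L[ℂ] HA) (B : HB →L[ℂ] HB) (x : HA ⊗[ℂ] HB) :
    tensorOp A B (x : HilbertTensor HA HB) = (mapL A B x : HA ⊗[ℂ] HB) :=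
  ContinuousLinearMap.completion_apply_coe _ _

theorem hilbertTensor_ext {S T : HilbertTensor HA HB →L[ℂ] HilbertTensor HA HB}
    (h : ∀ x : HA ⊗[ℂ] HB, S (x : HilbertTensor HA HB) = T (x : HilbertTensor HA HB)) : S = T := by
  ext x
  induction x using Completion.induction_on with
  | hp => exact isClosed_eq S.continuous T.continuous
  | ih x => exact h x

theorem tensorOp_mul (A A' : HA →L[ℂ] HA) (B B' : HB →L[ℂ] HB) :
    tensorOp (A * A') (B * B') = tensorOp A B * tensorOp A' B' :=
  hilbertTensor_ext fun x => by simp only [tensorOp_coe, mapL_mul, _root_.mul_apply_eq_comp]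

theorem tensorOp_mul_apply (A A' : HA →L[ℂ] HA) (B B' : HB →L[ℂ] HB) (x : HilbertTensor HA HB) :
    tensorOp A B (tensorOp A' B' x) = tensorOp (A * A') (B * B') x := by
  rw [tensorOp_mul]; rfl

theorem tensorOp_one_one : tensorOp (1 : HA →L[ℂ] HA) (1 : HB →L[ℂ] HB) = 1 :=
  hilbertTensor_ext fun x => by
    rw [tensorOp_coe, ContinuousLinearMap.one_def, ContinuousLinearMap.one_def, mapL_id_id]; rfl

theorem tensorOp_add_left (A A' : HA →L[ℂ] HA) (B : HB →L[ℂ] HB) :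
    tensorOp (A + A') B = tensorOp A B + tensorOp A' B :=
  hilbertTensor_ext fun x => by
    simp only [tensorOp_coe, mapL_add_left, _root_.add_apply, Completion.coe_add]

theorem tensorOp_add_right (A : HA →L[ℂ] HA) (B B' : HB →L[ℂ] HB) :
    tensorOp A (B + B') = tensorOp A B + tensorOp A B' :=
  hilbertTensor_ext fun x => by
    simp only [tensorOp_coe, mapL_add_right, _root_.add_apply, Completion.coe_add]

theorem tensorOp_smul_left (c : ℂ) (A : HA →L[ℂ] HA) (B : HB →L[ℂ] HB) :
    tensorOp (c • A) B = c • tensorOp A B :=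
  hilbertTensor_ext fun x => by
    simp only [tensorOp_coe, mapL_smul_left, _root_.smul_apply, Completion.coe_smul]

theorem tensorOp_smul_right (c : ℂ) (A : HA →L[ℂ] HA) (B : HB →L[ℂ] HB) :
    tensorOp A (c • B) = c • tensorOp A B :=
  hilbertTensor_ext fun x => by
    simp only [tensorOp_coe, mapL_smul_right, _root_.smul_apply, Completion.coe_smul]

/-- Symmetry is a closed condition, so density and additivity reduce it to pure tensors, where inner
products factor. -/
theorem isSymmetric_tensorOp [CompleteSpace HA] [CompleteSpace HB] {A : HA →L[ℂ] HA}
    {B : HB →L[ℂ] HB} (hA : IsSelfAdjoint A) (hB : IsSelfAdjoint B) :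
    (tensorOp A B : HilbertTensor HA HB →ₗ[ℂ] HilbertTensor HA HB).IsSymmetric := by
  intro x y
  induction x, y using Completion.induction_on₂ with
  | hp => exact isClosed_eq (by simp; fun_prop) (by simp; fun_prop)
  | ih x y =>
    simp only [ContinuousLinearMap.coe_coe, tensorOp_coe, Completion.inner_coe]
    induction x using TensorProduct.induction_on with
    | zero => simp
    | add x x' hx hx' => rw [map_add, inner_add_left, inner_add_left, hx, hx']
    | tmul a b =>
      induction y using TensorProduct.induction_on with
      | zero => simp
      | add y y' hy hy' => rw [map_add, inner_add_right, inner_add_right, hy, hy']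
      | tmul a' b' =>
        rw [mapL_tmul, mapL_tmul, inner_tmul, inner_tmul]
        congr 1
        · exact hA.isSymmetric _ _
        · exact hB.isSymmetric _ _

end TensorOp

/-! ### Chains in complex Hilbert spaces. -/

section ComplexChain

open Real

variable {E : Type*} [NormedAddCommGroup E] [InnerProductSpace ℂ E] {n : ℕ} {a b : ℕ → E}

theorem re_inner_comm (x y : E) : (inner ℂ x y).re = (inner ℂ y x).re := by
  rw [← inner_conj_symm, Complex.conj_re]

theorem chained_re_inner_eq_sum (a b : ℕ → E) :
    chained n (fun i j => (inner ℂ (a i) (b j)).re) =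
      ∑ k ∈ Finset.range (2 * n),
        (inner ℂ (chainSeq n a b k) (chainSeq n a b (k + 1))).re :=
  chained_eq_sum_chainSeq a b (fun x y => (inner ℂ x y).re) re_inner_comm
    fun x y => by simp

/-- The quantum bound on the chained functional of unit vectors. -/
theorem chained_re_inner_le (hn : 1 ≤ n) (ha : ∀ i ∈ Finset.Icc 1 n, ‖a i‖ = 1)
    (hb : ∀ i ∈ Finset.Icc 1 n, ‖b i‖ = 1) :
    chained n (fun i j => (inner ℂ (a i) (b j)).re) ≤ 2 * n * cos (π / (2 * n)) := by
  -- The real part of the complex inner product is the inner product of the underlying real space.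
  let _ := InnerProductSpace.rclikeToReal ℂ E
  obtain ⟨m, rfl⟩ : ∃ m, n = m + 1 := ⟨n - 1, by omega⟩
  have h := sum_inner_chain_le (2 * m) (chainSeq (m + 1) a b)
    (fun k hk => chainSeq_induction a b hn ha hb (p := fun x => ‖x‖ = 1) (fun x => by simp) hk)
    ((chainSeq_last a b).trans (congrArg Neg.neg (chainSeq_two_mul (i := 0) a b hn)).symm)
  rw [show (2 * (m + 1 : ℕ) : ℝ) = (2 * m : ℕ) + 2 by push_cast; ring, chained_re_inner_eq_sum]
  exact h

/-- In an extremal configuration the first vector of `b` is a rotation of the first vector of `a`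
in the plane spanned by the first and the middle vector of `a`. -/
theorem eq_rotation_of_chained_eq (hn : 1 ≤ n) (heven : Even n)
    (ha : ∀ i ∈ Finset.Icc 1 n, ‖a i‖ = 1) (hb : ∀ i ∈ Finset.Icc 1 n, ‖b i‖ = 1)
    (heq : chained n (fun i j => (inner ℂ (a i) (b j)).re) = 2 * n * cos (π / (2 * n))) :
    b 1 = (cos (π / (2 * n)) : ℂ) • a 1 + (sin (π / (2 * n)) : ℂ) • a (n / 2 + 1) := by
  let _ := InnerProductSpace.rclikeToReal ℂ E
  have h0 : chainSeq n a b 0 = a 1 := chainSeq_two_mul (i := 0) a b hn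
  have h1 : chainSeq n a b 1 = b 1 := chainSeq_two_mul_add_one a b 0
  have h2 : chainSeq n a b n = a (n / 2 + 1) := by
    have h := chainSeq_two_mul a b (by omega : n / 2 < n)
    rwa [Nat.two_mul_div_two_of_even heven] at h
  have h := chain_one_eq_of_sum_eq hn (chainSeq n a b)
    (fun k hk => chainSeq_induction a b hn ha hb (p := fun x => ‖x‖ = 1) (fun x => by simp) hk)
    (by rw [h0, chainSeq_last]) (by rw [chained_re_inner_eq_sum] at heq; exact heq)
  rw [h0, h1, h2] at h
  exact_mod_cast h

end ComplexChain

/-! ### The local bound, by integrating a pointwise inequality. -/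

theorem localValues_le {n : ℕ} (hn : 1 ≤ n) :
    ∀ x ∈ localValues.{w} n, x ≤ 2 * (n : ℝ) - 1 := by
  rintro x ⟨Ω, _, μ, _, α, β, hα, hβ, hα1, hβ1, rfl⟩
  have hint : ∀ i j, MeasureTheory.Integrable (fun ω => α i ω * β j ω) μ := fun i j =>
    MeasureTheory.Integrable.of_bound ((hα i).mul (hβ j)).aestronglyMeasurable 1
      (.of_forall fun ω => by
        rw [Real.norm_eq_abs, abs_mul]
        exact mul_le_one₀ (hα1 i ω) (abs_nonneg _) (hβ1 j ω))
  have hterm : ∀ i, MeasureTheory.Integrable (fun ω => α i ω * β i ω +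
      if i = n then -(α 1 ω * β i ω) else α (i + 1) ω * β i ω) μ := fun i => by
    split_ifs
    · exact (hint _ _).add (hint _ _).neg
    · exact (hint _ _).add (hint _ _)
  have hchain : MeasureTheory.Integrable (fun ω => chained n fun i j => α i ω * β j ω) μ :=
    MeasureTheory.integrable_finsetSum _ fun i _ => hterm i
  have heq : modifiedChained n (fun i j => ∫ ω, α i ω * β j ω ∂μ) =
      ∫ ω, modifiedChained n (fun i j => α i ω * β j ω) ∂μ := by
    simp only [modifiedChained]
    rw [MeasureTheory.integral_add hchain (hint _ _)]
    congr 1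
    simp only [chained]
    rw [MeasureTheory.integral_finsetSum _ fun i _ => hterm i]
    refine Finset.sum_congr rfl fun i _ => ?_
    split_ifs
    · rw [← MeasureTheory.integral_neg]
      exact (MeasureTheory.integral_add (hint _ _) (hint _ _).neg).symm
    · rw [MeasureTheory.integral_add (hint _ _) (hint _ _)]
  have hle : ∀ ω, modifiedChained n (fun i j => α i ω * β j ω) ≤ 2 * (n : ℝ) - 1 := by
    intro ω
    obtain ⟨m, rfl⟩ : ∃ m, n = m + 1 := ⟨n - 1, by omega⟩
    have h0 := chainSeq_two_mul (fun i => α i ω) (fun j => β j ω) hn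
    have h := sum_mul_antiperiodic_le (2 * m)
      (chainSeq (m + 1) (fun i => α i ω) (fun j => β j ω)) (β (m + 1 + 1) ω)
      (fun k hk => chainSeq_induction _ _ hn (fun i _ => hα1 i ω) (fun j _ => hβ1 j ω)
        (p := fun x => |x| ≤ 1) (fun x hx => by rwa [abs_neg]) hk)
      (hβ1 _ _) ((chainSeq_last _ _).trans (congrArg Neg.neg h0).symm)
    rw [modifiedChained, chained_eq_sum_chainSeq _ _ (fun x y : ℝ => x * y) mul_comm
      fun x y => mul_neg x y]
    rw [show chainSeq (m + 1) (fun i => α i ω) (fun j => β j ω) 0 = α 1 ω from h0] at h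
    push_cast at h ⊢
    exact h.trans (by linarith)
  rw [heq]
  calc _ ≤ ∫ _, (2 * (n : ℝ) - 1) ∂μ :=
        MeasureTheory.integral_mono (hchain.add (hint _ _)) (MeasureTheory.integrable_const _) hle
    _ = _ := by simp

/-! ### Quantum upper bound and consequences of saturation. -/

namespace Realization

variable {n : ℕ} {HA : Type u} {HB : Type v}
  [NormedAddCommGroup HA] [InnerProductSpace ℂ HA] [CompleteSpace HA]
  [NormedAddCommGroup HB] [InnerProductSpace ℂ HB] [CompleteSpace HB]

theorem norm_tensorOp_of_observable {A : HA →L[ℂ] HA} {B : HB →L[ℂ] HB}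
    (hA : IsObservable A) (hB : IsObservable B) (x : HilbertTensor HA HB) :
    ‖tensorOp A B x‖ = ‖x‖ := by
  have h : inner ℂ (tensorOp A B x) (tensorOp A B x) = inner ℂ x x :=
    calc _ = inner ℂ x (tensorOp A B (tensorOp A B x)) := isSymmetric_tensorOp hA.1 hB.1 _ _
      _ = _ := by rw [tensorOp_mul_apply, hA.2, hB.2, tensorOp_one_one]; rfl
  rw [@norm_eq_sqrt_re_inner ℂ, @norm_eq_sqrt_re_inner ℂ _ _ _ _ x, h]

theorem isObservable_one {H : Type u} [NormedAddCommGroup H] [InnerProductSpace ℂ H]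
    [CompleteSpace H] : IsObservable (1 : H →L[ℂ] H) := ⟨.one _, mul_one 1⟩

variable (R : Realization n HA HB)

theorem norm_A_ψ {i : ℕ} (hi : i ∈ Finset.Icc 1 n) : ‖tensorOp (R.A i) 1 R.ψ‖ = 1 := by
  rw [norm_tensorOp_of_observable (R.observable_A i hi) isObservable_one, R.norm_ψ]

theorem norm_B_ψ {j : ℕ} (hj : j ∈ Finset.Icc 1 (n + 1)) : ‖tensorOp 1 (R.B j) R.ψ‖ = 1 := by
  rw [norm_tensorOp_of_observable isObservable_one (R.observable_B j hj), R.norm_ψ]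

theorem corr_eq_re_inner {i : ℕ} (hi : i ∈ Finset.Icc 1 n) (j : ℕ) :
    R.corr i j = (inner ℂ (tensorOp (R.A i) 1 R.ψ) (tensorOp 1 (R.B j) R.ψ)).re := by
  have h := isSymmetric_tensorOp (R.observable_A i hi).1 (B := (1 : HB →L[ℂ] HB)) (.one _)
    R.ψ (tensorOp 1 (R.B j) R.ψ)
  rw [corr, ← mul_one (R.A i), ← one_mul (R.B j), tensorOp_mul]
  rw [mul_one, one_mul]
  exact congrArg Complex.re h.symm

theorem value_eq (hn : 1 ≤ n) : R.value =
    chained n (fun i j => (inner ℂ (tensorOp (R.A i) 1 R.ψ) (tensorOp 1 (R.B j) R.ψ)).re) +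
      (inner ℂ (tensorOp (R.A 1) 1 R.ψ) (tensorOp 1 (R.B (n + 1)) R.ψ)).re := by
  have h1 : 1 ∈ Finset.Icc 1 n := Finset.mem_Icc.2 ⟨le_rfl, hn⟩
  rw [value, modifiedChained, R.corr_eq_re_inner h1, chained, chained]
  congr 1
  refine Finset.sum_congr rfl fun i hi => ?_
  rw [R.corr_eq_re_inner hi, R.corr_eq_re_inner h1]
  split_ifs with h
  · rfl
  · rw [R.corr_eq_re_inner (by simp only [Finset.mem_Icc] at hi ⊢; omega)]

theorem chained_le (hn : 1 ≤ n) :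
    chained n (fun i j => (inner ℂ (tensorOp (R.A i) 1 R.ψ) (tensorOp 1 (R.B j) R.ψ)).re) ≤
      2 * n * Real.cos (Real.pi / (2 * n)) :=
  chained_re_inner_le hn (fun _ => R.norm_A_ψ) fun _ hi =>
    R.norm_B_ψ (Finset.Icc_subset_Icc_right n.le_succ hi)

theorem re_inner_le_one (hn : 1 ≤ n) :
    (inner ℂ (tensorOp (R.A 1) 1 R.ψ) (tensorOp 1 (R.B (n + 1)) R.ψ)).re ≤ 1 := by
  refine (re_inner_le_norm (𝕜 := ℂ) _ _).trans ?_
  rw [R.norm_A_ψ (by simp [hn]), R.norm_B_ψ (by simp), mul_one]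

theorem value_le (hn : 1 ≤ n) : R.value ≤ 2 * n * Real.cos (Real.pi / (2 * n)) + 1 := by
  rw [R.value_eq hn]
  exact add_le_add (R.chained_le hn) (R.re_inner_le_one hn)

theorem prob_eq (i j : ℕ) (a b : Fin 2) : R.prob i j a b =
    1 / 4 * (1 + (-1) ^ (a : ℕ) * (inner ℂ R.ψ (tensorOp (R.A i) 1 R.ψ)).re
      + (-1) ^ (b : ℕ) * (inner ℂ R.ψ (tensorOp 1 (R.B j) R.ψ)).re
      + (-1) ^ (a : ℕ) * (-1) ^ (b : ℕ) * R.corr i j) := by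
  have h1 : inner ℂ R.ψ R.ψ = 1 := by
    rw [inner_self_eq_norm_sq_to_K, R.norm_ψ]; simp
  have ha : ((-1 : ℂ) ^ (a : ℕ)) = (((-1) ^ (a : ℕ) : ℝ) : ℂ) := by push_cast; rfl
  have hb : ((-1 : ℂ) ^ (b : ℕ)) = (((-1) ^ (b : ℕ) : ℝ) : ℂ) := by push_cast; rfl
  have h2 : (1 / 2 : ℂ) = ((1 / 2 : ℝ) : ℂ) := by push_cast; rfl
  rw [prob, corr, outcomeProj, outcomeProj, ha, hb, h2]
  simp only [tensorOp_smul_left, tensorOp_smul_right, tensorOp_add_left, tensorOp_add_right,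
    tensorOp_one_one, _root_.add_apply, _root_.smul_apply, inner_add_right, inner_smul_right,
    one_apply_eq_self, h1, Complex.re_ofReal_mul, Complex.add_re, Complex.one_re,
    smul_add]
  ring

/-- Saturation forces the extra term to be 1, and ‖x - y‖² = 2 - 2 Re⟨x, y⟩ for unit vectors. -/
theorem A_ψ_eq_B_ψ_of_value_eq (hn : 1 ≤ n)
    (hR : R.value = 2 * n * Real.cos (Real.pi / (2 * n)) + 1) :
    tensorOp (R.A 1) 1 R.ψ = tensorOp 1 (R.B (n + 1)) R.ψ := by
  have h1 := R.chained_le hn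
  have h2 := R.re_inner_le_one hn
  rw [R.value_eq hn] at hR
  have hn1 := R.norm_A_ψ (i := 1) (by simp [hn])
  have hn2 := R.norm_B_ψ (j := n + 1) (by simp)
  rw [← sub_eq_zero, ← norm_eq_zero, ← sq_eq_zero_iff, @norm_sub_sq ℂ, hn1, hn2]
  simp only [RCLike.re_to_complex]
  linarith

theorem prob_eq_of_value_eq (hn : 2 ≤ n) (heven : Even n)
    (hR : R.value = 2 * n * Real.cos (Real.pi / (2 * n)) + 1) (a b : Fin 2) :
    R.prob (n / 2 + 1) (n + 1) a b = 1 / 4 := by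
  have hn1 : 1 ≤ n := by omega
  have hAB := R.A_ψ_eq_B_ψ_of_value_eq hn1 hR
  have m1 : 1 ∈ Finset.Icc 1 n := by simp [hn1]
  have mm : n / 2 + 1 ∈ Finset.Icc 1 n := by rw [Finset.mem_Icc]; omega
  have k1 : 1 ∈ Finset.Icc 1 (n + 1) := by simp
  have kn : n + 1 ∈ Finset.Icc 1 (n + 1) := by simp
  have hrot := eq_rotation_of_chained_eq hn1 heven (fun _ => R.norm_A_ψ)
    (fun i hi => R.norm_B_ψ (Finset.Icc_subset_Icc_right n.le_succ hi))
    (by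
      have h1 := R.chained_le hn1
      have h2 := R.re_inner_le_one hn1
      rw [R.value_eq hn1] at hR
      linarith)
  set c := Real.cos (Real.pi / (2 * n))
  set t := Real.sin (Real.pi / (2 * n))
  have hn' : (2 : ℝ) ≤ n := by exact_mod_cast hn
  have hθ : Real.pi / (2 * n) < Real.pi / 2 := by
    have := Real.pi_pos
    gcongr; linarith
  have hθ0 : 0 < Real.pi / (2 * n) := div_pos Real.pi_pos (by linarith)
  have hc : c ≠ 0 := (Real.cos_pos_of_mem_Ioo ⟨by linarith, hθ⟩).ne'
  have ht : t ≠ 0 := (Real.sin_pos_of_pos_of_lt_pi hθ0 (by linarith)).ne'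
  have sA {i} (hi : i ∈ Finset.Icc 1 n) :=
    isSymmetric_tensorOp (R.observable_A i hi).1 (B := (1 : HB →L[ℂ] HB)) (.one _)
  have sB {j} (hj : j ∈ Finset.Icc 1 (n + 1)) :=
    isSymmetric_tensorOp (A := (1 : HA →L[ℂ] HA)) (.one _) (R.observable_B j hj).1
  have qA {i} (hi : i ∈ Finset.Icc 1 n) (x) :
      tensorOp (R.A i) 1 (tensorOp (R.A i) (1 : HB →L[ℂ] HB) x) = x := by
    rw [tensorOp_mul_apply, (R.observable_A i hi).2, one_mul, tensorOp_one_one]; rfl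
  have qB {j} (hj : j ∈ Finset.Icc 1 (n + 1)) (x) :
      tensorOp 1 (R.B j) (tensorOp (1 : HA →L[ℂ] HA) (R.B j) x) = x := by
    rw [tensorOp_mul_apply, (R.observable_B j hj).2, one_mul, tensorOp_one_one]; rfl
  have comm (i j : ℕ) (x) : tensorOp (R.A i) 1 (tensorOp 1 (R.B j) x) =
      tensorOp 1 (R.B j) (tensorOp (R.A i) 1 x) := by
    simp only [tensorOp_mul_apply, one_mul, mul_one]
  have hanti := anticommute_of_rotation (qA m1) (qA mm) (qB k1) (comm _ _) (comm _ _)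
    (Real.cos_sq_add_sin_sq _) hc ht hrot
  have e1 : inner ℂ R.ψ (tensorOp (R.A (n / 2 + 1)) 1 R.ψ) = 0 :=
    inner_eq_zero_of_anticommute (sA m1) (sB kn) (qA m1) (comm _ _) (comm _ _)
      (by rw [add_comm]; exact hanti) hAB
  have e2 : inner ℂ R.ψ (tensorOp (R.A 1) 1 R.ψ) = 0 := by
    refine inner_eq_zero_of_anticommute
      -- Solving the rotation for A_{n/2+1}ψ, with A₁ψ replaced by Bₙ₊₁ψ, gives this operator of
      -- Bob.
      (W := ((t⁻¹ : ℝ) : ℂ) • (tensorOp 1 (R.B 1) - (c : ℂ) • tensorOp 1 (R.B (n + 1))))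
      (sA mm) ?_ (qA mm) (fun x => ?_) (fun x => ?_) hanti ?_
    · have h1 := sB k1
      have h2 := sB kn
      exact (h1.sub (h2.smul (by simp))).smul (by simp)
    · simp only [_root_.smul_apply, _root_.sub_apply, map_smul, map_sub, comm]
    · simp only [_root_.smul_apply, _root_.sub_apply, map_smul, map_sub, comm]
    · have ht' : (t : ℂ) ≠ 0 := by exact_mod_cast ht
      simp only [_root_.smul_apply, _root_.sub_apply, hrot, ← hAB, add_sub_cancel_left, smul_smul]
      push_cast
      rw [inv_mul_cancel₀ ht', one_smul]
  -- The correlator is Re⟨A_{n/2+1}ψ, A₁ψ⟩, half the expectation of the anticommutator.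
  have e3 : R.corr (n / 2 + 1) (n + 1) = 0 := by
    rw [R.corr_eq_re_inner mm, ← hAB]
    have h := congrArg (fun x => (inner ℂ R.ψ x).re) hanti
    simp only [inner_add_right, inner_zero_right, Complex.add_re, Complex.zero_re] at h
    have h1 : inner ℂ (tensorOp (R.A 1) 1 R.ψ) (tensorOp (R.A (n / 2 + 1)) 1 R.ψ) = _ :=
      sA m1 R.ψ (tensorOp (R.A (n / 2 + 1)) 1 R.ψ)
    have h2 : inner ℂ (tensorOp (R.A (n / 2 + 1)) 1 R.ψ) (tensorOp (R.A 1) 1 R.ψ) = _ :=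
      sA mm R.ψ (tensorOp (R.A 1) 1 R.ψ)
    simp only [ContinuousLinearMap.coe_coe] at h1 h2
    rw [← h1, ← h2, re_inner_comm] at h
    linarith
  rw [prob_eq, e1, e3, ← hAB, e2]
  simp

end Realization

/-! ### Min-entropy, and the gap between the local and quantum bounds. -/

theorem minEntropy_of_eq {p : Fin 2 → Fin 2 → ℝ} (hp : ∀ a b, p a b = 1 / 4) :
    minEntropy p = 2 := by
  simp only [minEntropy, hp, ciSup_const]
  rw [show (1 / 4 : ℝ) = 2 ^ (-2 : ℝ) by
    rw [Real.rpow_neg (by norm_num), Real.rpow_two]; norm_num, Real.logb_rpow] <;> norm_num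

/-- The maximal quantum value exceeds the local bound. -/
theorem two_mul_sub_one_lt {n : ℕ} (hn : 2 ≤ n) :
    2 * (n : ℝ) - 1 < 2 * n * Real.cos (Real.pi / (2 * n)) + 1 := by
  have hn' : (2 : ℝ) ≤ n := by exact_mod_cast hn
  -- The quadratic bound costs at most π²/(4n), less than 2 already at n = 2.
  have h := Real.one_sub_sq_div_two_le_cos (x := Real.pi / (2 * n))
  have h1 : 2 * (n : ℝ) * (1 - (Real.pi / (2 * n)) ^ 2 / 2) = 2 * n - Real.pi ^ 2 / (4 * n) := by
    field_simp
    ring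
  have h2 : Real.pi ^ 2 / (4 * n) < 2 := by
    rw [div_lt_iff₀ (by linarith)]
    nlinarith [Real.pi_lt_d2, Real.pi_pos]
  have h3 := mul_le_mul_of_nonneg_left h (by linarith : 0 ≤ 2 * (n : ℝ))
  linarith

/-! ### A two-qubit realization attaining the bound. -/

section Attained

open Real

/-- The real reflection with axis at half the angle `φ`. -/
noncomputable def reflection (φ : ℝ) :
    EuclideanSpace ℂ (ULift.{u} (Fin 2)) →L[ℂ] EuclideanSpace ℂ (ULift.{u} (Fin 2)) :=
  Matrix.toEuclideanCLM (𝕜 := ℂ)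
    (!![(cos φ : ℂ), (sin φ : ℂ); (sin φ : ℂ), -(cos φ : ℂ)].submatrix
      (Equiv.ulift (α := Fin 2)) Equiv.ulift)

theorem isObservable_reflection (φ : ℝ) : IsObservable (reflection.{u} φ) := by
  have hcs : (cos φ : ℂ) ^ 2 + (sin φ : ℂ) ^ 2 = 1 := by exact_mod_cast cos_sq_add_sin_sq φ
  constructor
  · refine IsSelfAdjoint.map ?_ (Matrix.toEuclideanCLM (𝕜 := ℂ))
    rw [IsSelfAdjoint, Matrix.star_eq_conjTranspose, Matrix.conjTranspose_submatrix]
    congr 1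
    ext i j
    fin_cases i <;> fin_cases j <;>
      simp [-Complex.ofReal_cos, -Complex.ofReal_sin, Matrix.conjTranspose_apply]
  · rw [reflection, ← map_mul, Matrix.submatrix_mul_equiv, Matrix.mul_fin_two]
    convert map_one (Matrix.toEuclideanCLM (n := ULift.{u} (Fin 2)) (𝕜 := ℂ))
    rw [← Matrix.submatrix_one_equiv (Equiv.ulift (α := Fin 2)), Matrix.one_fin_two]
    congr 1
    ext i j
    fin_cases i <;> fin_cases j <;> 
      simp [-Complex.ofReal_cos, -Complex.ofReal_sin, mul_comm, ← sq, hcs, add_comm (_ ^ 2)]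

/-- The standard basis of the qubit space. -/
noncomputable def qubit (i : Fin 2) : EuclideanSpace ℂ (ULift.{u} (Fin 2)) :=
  EuclideanSpace.single ⟨i⟩ 1

theorem inner_qubit (i j : Fin 2) : inner ℂ (qubit.{u} i) (qubit j) = if i = j then 1 else 0 := by
  simp [qubit, EuclideanSpace.inner_single_left]

theorem inner_qubit_reflection (φ : ℝ) (i j : Fin 2) :
    inner ℂ (qubit.{u} i) (reflection φ (qubit j)) =
      !![(cos φ : ℂ), (sin φ : ℂ); (sin φ : ℂ), -(cos φ : ℂ)] i j := by
  rw [qubit, qubit, EuclideanSpace.inner_single_left, reflection, EuclideanSpace.single,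
    Matrix.toEuclideanCLM_toLp]
  simp [Equiv.ulift]

/-- The unnormalized maximally entangled state of two qubits. -/
noncomputable def bellVector :
    EuclideanSpace ℂ (ULift.{u} (Fin 2)) ⊗[ℂ] EuclideanSpace ℂ (ULift.{v} (Fin 2)) :=
  qubit 0 ⊗ₜ[ℂ] qubit 0 + qubit 1 ⊗ₜ[ℂ] qubit 1

theorem inner_bellVector_self : inner ℂ bellVector.{u, v} bellVector = 2 := by
  simp only [bellVector, inner_add_left, inner_add_right, TensorProduct.inner_tmul, inner_qubit]
  norm_num

/-- The Bell vector turns the pairing into the trace of the product of the two symmetric matrices.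
-/
theorem inner_bellVector_reflection (φ χ : ℝ) :
    inner ℂ bellVector.{u, v} (TensorProduct.mapL (reflection φ) (reflection χ) bellVector) =
      ((2 * cos (φ - χ) : ℝ) : ℂ) := by
  simp only [bellVector, map_add, TensorProduct.mapL_tmul, inner_add_left, inner_add_right,
    TensorProduct.inner_tmul, inner_qubit_reflection, cos_sub]
  simp [-Complex.ofReal_cos, -Complex.ofReal_sin]
  ring

/-- The realization with the maximally entangled state of two qubits and regularly spaced
measurements in a plane. -/
noncomputable def optimalRealization (n : ℕ) :
    Realization n (EuclideanSpace ℂ (ULift.{u} (Fin 2)))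
      (EuclideanSpace ℂ (ULift.{v} (Fin 2))) where
  ψ := (((√2)⁻¹ : ℝ) : ℂ) • (bellVector : HilbertTensor _ _)
  -- Alice takes even and Bob odd multiples of π/(2n), so chain neighbours differ by one step; Bob's
  -- last angle 0 copies `A 1`.
  A i := reflection ((2 * (i - 1)) * (π / (2 * n)))
  B j := reflection (if j = n + 1 then 0 else (2 * j - 1) * (π / (2 * n)))
  norm_ψ := by
    rw [norm_smul, UniformSpace.Completion.norm_coe, @norm_eq_sqrt_re_inner ℂ _ _ _ _ bellVector,
      inner_bellVector_self, Complex.norm_real, norm_inv, norm_of_nonneg (sqrt_nonneg 2)]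
    exact inv_mul_cancel₀ (by positivity)
  observable_A _ _ := isObservable_reflection _
  observable_B _ _ := isObservable_reflection _

theorem corr_optimalRealization (n i j : ℕ) : (optimalRealization.{u, v} n).corr i j =
    cos ((2 * (i - 1)) * (π / (2 * n)) - if j = n + 1 then 0 else (2 * j - 1) * (π / (2 * n))) := by
  simp only [Realization.corr, optimalRealization]
  rw [map_smul, inner_smul_left, inner_smul_right, tensorOp_coe, UniformSpace.Completion.inner_coe,
    inner_bellVector_reflection, Complex.conj_ofReal, ← Complex.ofReal_mul, ← Complex.ofReal_mul,
    Complex.ofReal_re]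
  have h : (√2)⁻¹ * (√2)⁻¹ = 1 / 2 := by
    rw [← mul_inv, mul_self_sqrt zero_le_two, one_div]
  linear_combination
    2 * cos ((2 * (i - 1)) * (π / (2 * n)) -
      if j = n + 1 then 0 else (2 * j - 1) * (π / (2 * n))) * h

theorem value_optimalRealization {n : ℕ} (hn : 1 ≤ n) :
    (optimalRealization.{u, v} n).value = 2 * n * cos (π / (2 * n)) + 1 := by
  have hn' : (n : ℝ) ≠ 0 := by positivity
  rw [Realization.value, modifiedChained, chained]
  have hterm : ∀ i ∈ Finset.Icc 1 n, (optimalRealization.{u, v} n).corr i i +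
      (if i = n then -(optimalRealization.{u, v} n).corr 1 i
        else (optimalRealization.{u, v} n).corr (i + 1) i) = 2 * cos (π / (2 * n)) := by
    intro i hi
    have hi' : i ≠ n + 1 := by simp only [Finset.mem_Icc] at hi; omega
    simp only [corr_optimalRealization, if_neg hi']
    have e1 : 2 * ((i : ℝ) - 1) * (π / (2 * n)) - (2 * i - 1) * (π / (2 * n)) =
        -(π / (2 * n)) := by ring
    rw [e1, cos_neg, two_mul (cos _)]
    congr 1
    split_ifs with h
    -- On the closing edge the shift by π absorbs the sign of -A₁.
    · have e2 : 2 * (((1 : ℕ) : ℝ) - 1) * (π / (2 * n)) - (2 * i - 1) * (π / (2 * n)) =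
          π / (2 * n) - π := by
        rw [h]; push_cast; field_simp; ring
      rw [e2, cos_sub_pi, neg_neg]
    · congr 1; push_cast; ring
  rw [Finset.sum_congr rfl hterm, corr_optimalRealization]
  simp
  ring

end Attained

theorem isGreatest_quantumValues {n : ℕ} (hn : 1 ≤ n) :
    IsGreatest (quantumValues.{u, v} n) (2 * n * Real.cos (Real.pi / (2 * n)) + 1) := by
  refine ⟨⟨_, _, _, _, inferInstance, _, _, inferInstance, optimalRealization.{u, v} n,
    (value_optimalRealization hn).symm⟩, ?_⟩
  rintro x ⟨HA, HB, _, _, _, _, _, _, R, rfl⟩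
  exact R.value_le hn

end ChainedBell

theorem mainTheorem7 (n : ℕ) (hn : 2 ≤ n) (heven : Even n) :
    -- the inequality: local hidden variable models reach at most `2n - 1`
    (∀ x ∈ ChainedBell.localValues.{w} n, x ≤ 2 * (n : ℝ) - 1) ∧
    -- the maximal quantum value is `B_n^max + 1`, a genuine violation
    IsGreatest (ChainedBell.quantumValues.{u, v} n)
      (2 * (n : ℝ) * Real.cos (Real.pi / (2 * (n : ℝ))) + 1) ∧
    2 * (n : ℝ) - 1 < 2 * (n : ℝ) * Real.cos (Real.pi / (2 * (n : ℝ))) + 1 ∧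
    -- what every maximal violation implies
    ∀ (HA : Type u) (HB : Type v)
      [NormedAddCommGroup HA] [InnerProductSpace ℂ HA] [CompleteSpace HA]
      [NormedAddCommGroup HB] [InnerProductSpace ℂ HB] [CompleteSpace HB]
      (R : ChainedBell.Realization n HA HB), R.IsMaximal →
        ChainedBell.tensorOp (R.A 1) 1 R.ψ = ChainedBell.tensorOp 1 (R.B (n + 1)) R.ψ ∧
        (∀ a b : Fin 2, R.prob (n / 2 + 1) (n + 1) a b = 1 / 4) ∧
        ChainedBell.minEntropy (R.prob (n / 2 + 1) (n + 1)) = 2 := by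
  refine ⟨ChainedBell.localValues_le (by omega), ChainedBell.isGreatest_quantumValues (by omega),
    ChainedBell.two_mul_sub_one_lt hn, ?_⟩
  intro HA HB _ _ _ _ _ _ R hR
  have hvalue := IsGreatest.unique hR (ChainedBell.isGreatest_quantumValues (by omega : 1 ≤ n))
  have hprob := R.prob_eq_of_value_eq hn heven hvalue
  exact ⟨R.A_ψ_eq_B_ψ_of_value_eq (by omega) hvalue, hprob, ChainedBell.minEntropy_of_eq hprob⟩
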